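/- For $p\in(0,1)$ call $w:\mathbb R\to\mathbb R$ a self-similar profile with exponent $p$ if $w\in C^2(\mathbb R)$, $w$ is odd, $$w''+\tfrac12\eta w'+w|w|^{p-1}-\tfrac{1}{1-p}\,w=0\quad\text{for all }\eta\in\mathbb R,$$ and $w(\eta)\to\pm(1-p)^{1/(1-p)}$ as $\eta\to\pm\infty$. (Here $w|w|^{p-1}$ is $0$ where $w=0$.) Let $(S_0)$ be the problem of finding $w\in C([0,\infty))\cap C^2((0,\infty))$ with $$w''+\tfrac12\eta w'-w=-1\ \text{ and }\ w(\eta)>0\quad\text{for all }\eta>0,\qquad w(0)=0,\qquad w(\eta)\to1\ \text{ as }\eta\to\infty .$$ Then $(S_0)$ has exactly one solution, namely $$w_0(\eta)=1-\frac{4}{\sqrt\pi}\,(2+\eta^2)\int_\eta^\infty\frac{e^{-s^2/4}}{(2+s^2)^2}\,ds\qquad(\eta\ge0),$$ where the integral converges. Let $p_n=1/(2n)$ for $n=1,2,\dots$ and, for each $n$, let $w_{p_n}$ be a self-similar profile with exponent $p_n$. Then there are $w_*\in C^1([0,\infty))$ and a subsequence $(n_l)$ such that for every $X>0$, $w_{p_{n_l}}\to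 w_*$ and $w_{p_{n_l}}'\to w_*'$ uniformly on $[0,X]$. Moreover, whenever $w_*\in C^1([0,\infty))$ is such that for every $X>0$ some subsequence (possibly depending on $X$) satisfies $w_{p_{n_l}}\to w_*$ and $w_{p_{n_l}}'\to w_*'$ uniformly on $[0,X]$, the function $w_*$ is the unique solution of $(S_0)$, that is, $$w_*(\eta)=1-\frac{4}{\sqrt\pi}\,(2+\eta^2)\int_\eta^\infty\frac{e^{-s^2/4}}{(2+s^2)^2}\,ds\qquad\text{for all }\eta\ge0.$$ -/

import Mathlib

open Set Filter Topology MeasureTheory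

/-- The nonlinearity `f_p(u) = u |u|^(p-1)` (with `f_p(0) = 0`). -/
noncomputable def fNonlin (p u : ℝ) : ℝ := u * |u| ^ (p - 1)

/-- `w` is a self-similar profile with exponent `p`: an odd, twice continuously differentiable
solution on the whole line of `w'' + (η/2) w' + f_p(w) - w/(1-p) = 0` which connects the two
constant solutions `-(1-p)^(1/(1-p))` and `(1-p)^(1/(1-p))`. -/
structure IsSelfSimilarProfile (p : ℝ) (w : ℝ → ℝ) : Prop where
  contDiff : ContDiff ℝ 2 w
  ode : ∀ η : ℝ,
    deriv (deriv w) η + 1 / 2 * η * deriv w η + fNonlin p (w η) - 1 / (1 - p) * w η = 0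
  odd : ∀ η : ℝ, w (-η) = -w η
  tendsto_top : Tendsto w atTop (𝓝 ((1 - p) ^ (1 / (1 - p))))
  tendsto_bot : Tendsto w atBot (𝓝 (-(1 - p) ^ (1 / (1 - p))))

/-- The exponents `p_n = 1/(2n)`, `n ≥ 1`. -/
noncomputable def pSeq (n : ℕ) : ℝ := 1 / (2 * (n : ℝ))

/-- `u_l → v` and `u_l' → v'` uniformly on `[0, X]`, where `v` is a function on `[0, ∞)`
(so that `v'(0)` is the one-sided derivative); the `u_l` are functions on `ℝ`. -/
def TendstoC1On (u : ℕ → ℝ → ℝ) (v : ℝ → ℝ) (X : ℝ) : Prop :=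
  TendstoUniformlyOn u v atTop (Icc 0 X) ∧
    TendstoUniformlyOn (fun l => deriv (u l)) (derivWithin v (Ici 0)) atTop (Icc 0 X)

/-- `v` is a limit profile of the sequence `u_1, u_2, …`: `v ∈ C¹([0, ∞))` and for every `X > 0`
some subsequence converges to `v`, together with first derivatives, uniformly on `[0, X]`.
Only the values of `v` on `[0, ∞)` matter. -/
def IsLimitProfile (u : ℕ → ℝ → ℝ) (v : ℝ → ℝ) : Prop :=
  ContDiffOn ℝ 1 v (Ici 0) ∧
    ∀ X : ℝ, 0 < X → ∃ φ : ℕ → ℕ, StrictMono φ ∧ (∀ l, 1 ≤ φ l) ∧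
      TendstoC1On (fun l => u (φ l)) v X

/-- `w ∈ C([0, ∞)) ∩ C²((0, ∞))` solves the limit boundary value problem `(S₀)`.
Only the values of `w` on `[0, ∞)` matter. -/
structure SolvesS0 (w : ℝ → ℝ) : Prop where
  continuousOn : ContinuousOn w (Ici 0)
  contDiffOn : ContDiffOn ℝ 2 w (Ioi 0)
  ode : ∀ η : ℝ, 0 < η → deriv (deriv w) η + 1 / 2 * η * deriv w η - w η = -1
  zero : w 0 = 0
  tendsto_top : Tendsto w atTop (𝓝 1)
  pos : ∀ η : ℝ, 0 < η → 0 < w η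

/-- `I(η) = ∫_η^∞ exp(-s²/4) (2 + s²)⁻² ds`. -/
noncomputable def tailIntegral (η : ℝ) : ℝ :=
  ∫ s in Ioi η, Real.exp (-s ^ 2 / 4) / (2 + s ^ 2) ^ 2

/-!
The proof shows that the whole family of profiles converges, as `p → 0`, to the explicit solution of
the limit problem, locally uniformly together with first derivatives; no compactness argument is
needed, and every limit profile must be that solution.

*The limit problem.* The function `2 + η²` solves `y'' + η y' / 2 - y = 0`, and the formula for
`limitSolution` is what reduction of order gives; its value at `0` comes from
`∫₀^∞ exp (-s² / 4) / (2 + s²)² ds = √π / 8` (`tailIntegral_zero`). Uniqueness is the maximum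
principle for the linear equation `d'' + η d' / 2 - d = g` (`abs_le_of_ode`).

*Bounds for the profiles.* Since `η ≥ 0`, the energy `w'² / 2 + potential p w` decreases, while its
value at infinity is at least the global maximum of the potential. This forbids a zero of `w` on
`(0, ∞)` (`IsSelfSimilarProfile.ne_zero_of_pos`) and bounds `w'(0)` from below. The maximum principle
gives `w ≤ (1 - p) ^ (1 / (1 - p))`; from this, on `[0, ∞)`, `w` is increasing and concave,
`w' ≤ 4`, and `w` is bounded below away from the origin, all uniformly in `p`.

*Convergence.* The difference `d = w - limitSolution` satisfies `d'' + η d' / 2 - d = g` with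
`g = 1 - w ^ p + p w / (1 - p)`. On `[0, δ]` the difference is small because both functions are; on
`[δ, ∞)` the lower bound for `w` makes `g` tend to `0` uniformly as `p → 0`, so the maximum principle
applies again (`eventually_abs_sub_limitSolution_le`). The derivatives follow by interpolation
between `d` and the bounded `d''` (`eventually_abs_deriv_sub_limitSolutionDeriv_le`).
-/

/-! ### Comparison principles on a half-line -/

/-- Maximum principle on a half-line: a function which is at most `M` at the left end point and
in the limit stays at most `M`, provided that it is strictly convex at each critical point where it
exceeds `M`. -/
lemma le_of_maximum_principle {d d₁ d₂ : ℝ → ℝ} {a M L : ℝ} (hc : ContinuousOn d (Ici a))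
    (h₁ : ∀ x, a < x → HasDerivAt d (d₁ x) x) (h₂ : ∀ x, a < x → HasDerivAt d₁ (d₂ x) x)
    (hlim : Tendsto d atTop (𝓝 L)) (hL : L ≤ M) (ha : d a ≤ M)
    (hconv : ∀ x, a < x → d₁ x = 0 → M < d x → 0 < d₂ x) :
    ∀ x, a ≤ x → d x ≤ M := by
  intro x hx
  by_contra! hM
  obtain ⟨R, hRx, hR⟩ : ∃ R, x ≤ R ∧ d R < d x :=
    ((eventually_ge_atTop x).and (hlim.eventually_lt_const (hL.trans_lt hM))).exists
  obtain ⟨c, hcI, hmax⟩ := isCompact_Icc.exists_isMaxOn (nonempty_Icc.2 (hx.trans hRx))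
    (hc.mono Icc_subset_Ici_self)
  have hxc : d x ≤ d c := hmax ⟨hx, hRx⟩
  have hac : a < c := lt_of_le_of_ne hcI.1 (by rintro rfl; linarith)
  have hcR : c < R := lt_of_le_of_ne hcI.2 (by rintro rfl; linarith)
  have hloc : IsLocalMax d c := hmax.isLocalMax (Icc_mem_nhds hac hcR)
  have hd₁ : d₁ c = 0 := hloc.hasDerivAt_eq_zero (h₁ c hac)
  have hd₂ : 0 < d₂ c := hconv c hac hd₁ (hM.trans_le hxc)
  have hderiv : deriv d =ᶠ[𝓝 c] d₁ := by
    filter_upwards [Ioi_mem_nhds hac] with y hy using (h₁ y hy).deriv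
  have hmin : IsLocalMin d c := by
    refine isLocalMin_of_deriv_deriv_pos ?_ ?_ (h₁ c hac).continuousAt
    · rw [hderiv.deriv_eq, (h₂ c hac).deriv]; exact hd₂
    · rw [hderiv.eq_of_nhds, hd₁]
  -- A point that is both a local maximum and a local minimum has a neighbourhood of constancy.
  have hconst : d =ᶠ[𝓝 c] fun _ => d c := by
    filter_upwards [hloc, hmin] with y h h' using le_antisymm h h'
  have hzero : d₁ =ᶠ[𝓝 c] fun _ => 0 := by
    refine hderiv.symm.trans ?_
    simpa using hconst.deriv
  have : d₂ c = 0 := by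
    rw [← (h₂ c hac).deriv, hzero.deriv_eq, deriv_const]
  linarith

/-- Solutions of `d'' + η d' / 2 - d = g` are controlled by their boundary values and by `g`. -/
lemma abs_le_of_ode {d d₁ d₂ g : ℝ → ℝ} {a M L : ℝ} (hc : ContinuousOn d (Ici a))
    (h₁ : ∀ x, a < x → HasDerivAt d (d₁ x) x) (h₂ : ∀ x, a < x → HasDerivAt d₁ (d₂ x) x)
    (hode : ∀ x, a < x → d₂ x + 1 / 2 * x * d₁ x - d x = g x)
    (hlim : Tendsto d atTop (𝓝 L)) (hL : |L| ≤ M) (ha : |d a| ≤ M)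
    (hg : ∀ x, a < x → |g x| ≤ M) {x : ℝ} (hx : a ≤ x) : |d x| ≤ M := by
  rw [abs_le]
  constructor
  · have := le_of_maximum_principle (d := fun x => -d x) (d₁ := fun x => -d₁ x)
      (d₂ := fun x => -d₂ x) (M := M) hc.neg (fun x hx => (h₁ x hx).neg)
      (fun x hx => (h₂ x hx).neg) hlim.neg (by linarith [abs_le.1 hL]) (by linarith [abs_le.1 ha])
      (fun y hy h0 hM => by
        have h := hode y hy
        rw [neg_eq_zero.1 h0] at h
        linarith [abs_le.1 (hg y hy)]) x hx
    linarith
  · exact le_of_maximum_principle hc h₁ h₂ hlim (abs_le.1 hL).2 (abs_le.1 ha).2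
      (fun y hy h0 hM => by
        have h := hode y hy
        rw [h0] at h
        linarith [abs_le.1 (hg y hy)]) x hx

/-- With the integrating factor `exp (η² / 4)`, the inequality `u'' + η u' / 2 ≤ 0` says that
`exp (η² / 4) u'` decreases. Were `u'` negative somewhere, it would remain so, and `u` could not
approach its supremum at infinity. -/
lemma deriv_nonneg_of_ode_nonpos {u u₁ u₂ : ℝ → ℝ} {L : ℝ}
    (h₁ : ∀ x, HasDerivAt u (u₁ x) x) (h₂ : ∀ x, HasDerivAt u₁ (u₂ x) x)
    (hode : ∀ x, 0 ≤ x → u₂ x + 1 / 2 * x * u₁ x ≤ 0)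
    (hlim : Tendsto u atTop (𝓝 L)) (hL : ∀ x, 0 ≤ x → u x ≤ L) {a : ℝ} (ha : 0 ≤ a) :
    0 ≤ u₁ a := by
  by_contra! hneg
  have hq : ∀ x, HasDerivAt (fun x => Real.exp (x ^ 2 / 4) * u₁ x)
      (Real.exp (x ^ 2 / 4) * (u₂ x + 1 / 2 * x * u₁ x)) x := fun x => by
    refine (((((hasDerivAt_id' x).pow 2).div_const 4).exp).mul (h₂ x)).congr_deriv ?_
    simp only [Nat.cast_ofNat, pow_one, mul_one, Nat.add_one_sub_one, Pi.pow_apply]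
    ring
  have hanti : AntitoneOn (fun x => Real.exp (x ^ 2 / 4) * u₁ x) (Ici 0) := by
    refine antitoneOn_of_deriv_nonpos (convex_Ici 0)
      (fun x _ => (hq x).continuousAt.continuousWithinAt)
      (fun x _ => (hq x).differentiableAt.differentiableWithinAt) fun x hx => ?_
    rw [interior_Ici] at hx
    rw [(hq x).deriv]
    exact mul_nonpos_of_nonneg_of_nonpos (Real.exp_pos _).le (hode x (le_of_lt hx))
  have hu₁ : ∀ x, a ≤ x → u₁ x < 0 := fun x hx => by
    have h : Real.exp (x ^ 2 / 4) * u₁ x ≤ Real.exp (a ^ 2 / 4) * u₁ a :=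
      hanti ha (ha.trans hx) hx
    have h' : Real.exp (a ^ 2 / 4) * u₁ a < 0 := mul_neg_of_pos_of_neg (Real.exp_pos _) hneg
    exact neg_of_mul_neg_right (h.trans_lt h') (Real.exp_pos _).le
  have hstrict : StrictAntiOn u (Ici a) := by
    refine strictAntiOn_of_deriv_neg (convex_Ici a)
      (fun x _ => (h₁ x).continuousAt.continuousWithinAt) fun x hx => ?_
    rw [interior_Ici] at hx
    rw [(h₁ x).deriv]
    exact hu₁ x (le_of_lt hx)
  have hlt : u (a + 1) < u a := hstrict (mem_Ici.2 le_rfl) (mem_Ici.2 (by linarith)) (by linarith)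
  have hle : L ≤ u (a + 1) := by
    refine le_of_tendsto hlim ?_
    filter_upwards [eventually_ge_atTop (a + 1)] with x hx
    exact hstrict.antitoneOn (mem_Ici.2 (by linarith)) (mem_Ici.2 (by linarith)) hx
  linarith [hL a ha]

/-- Landau-type interpolation: a bound for `d` and a bound for `d''` together bound `d'`. -/
lemma abs_deriv_le_of_abs_le {d d₁ d₂ : ℝ → ℝ} {x h ε K : ℝ} (hh : 0 < h)
    (h₁ : ∀ y, HasDerivAt d (d₁ y) y) (h₂ : ∀ y, HasDerivAt d₁ (d₂ y) y)
    (hd : ∀ y ∈ Icc x (x + h), |d y| ≤ ε) (hd₂ : ∀ y ∈ Icc x (x + h), |d₂ y| ≤ K) :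
    |d₁ x| ≤ 2 * ε / h + K * h := by
  obtain ⟨ξ, hξ, hslope⟩ := exists_hasDerivAt_eq_slope d d₁ (show x < x + h by linarith)
    (fun y _ => (h₁ y).continuousAt.continuousWithinAt) fun y _ => h₁ y
  have hdξ : |d₁ ξ| ≤ 2 * ε / h := by
    rw [hslope, add_sub_cancel_left, abs_div, abs_of_pos hh]
    gcongr
    have := abs_sub (d (x + h)) (d x)
    linarith [hd x ⟨le_rfl, by linarith⟩, hd (x + h) ⟨by linarith, le_rfl⟩]
  have hlip : |d₁ ξ - d₁ x| ≤ K * h := by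
    have hK : 0 ≤ K := (abs_nonneg _).trans (hd₂ x ⟨le_rfl, by linarith⟩)
    have := (convex_Icc x (x + h)).norm_image_sub_le_of_norm_hasDerivWithin_le
      (f := d₁) (f' := d₂) (C := K) (fun y _ => (h₂ y).hasDerivWithinAt) hd₂
      (left_mem_Icc.2 (by linarith)) (Ioo_subset_Icc_self hξ)
    simp only [Real.norm_eq_abs] at this
    refine this.trans ?_
    rw [abs_of_pos (by linarith [hξ.1])]
    gcongr
    linarith [hξ.2]
  have := abs_sub_abs_le_abs_sub (d₁ x) (d₁ ξ)
  rw [abs_sub_comm] at this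
  linarith

/-! ### The explicit solution of the limit problem -/

/-- The integrand of `tailIntegral`, on the whole line. -/
noncomputable def tailDensity (s : ℝ) : ℝ := Real.exp (-s ^ 2 / 4) / (2 + s ^ 2) ^ 2

lemma tailDensity_pos (s : ℝ) : 0 < tailDensity s := by
  unfold tailDensity; positivity

lemma continuous_tailDensity : Continuous tailDensity := by
  unfold tailDensity
  fun_prop (disch := intro x; positivity)

lemma integrable_exp_neg_sq_div_four : Integrable fun s : ℝ => Real.exp (-s ^ 2 / 4) := by
  convert integrable_exp_neg_mul_sq (b := 1 / 4) (by norm_num) using 3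
  ring

lemma tailDensity_le {a s : ℝ} (ha : 0 ≤ a) (has : a ≤ s) :
    tailDensity s ≤ Real.exp (-s ^ 2 / 4) / (2 + a ^ 2) ^ 2 := by
  unfold tailDensity
  gcongr

lemma integrable_tailDensity : Integrable tailDensity := by
  refine integrable_exp_neg_sq_div_four.mono' continuous_tailDensity.aestronglyMeasurable
    (Eventually.of_forall fun s => ?_)
  rw [Real.norm_of_nonneg (tailDensity_pos s).le]
  exact div_le_self (Real.exp_pos _).le (one_le_pow₀ (by nlinarith [sq_nonneg s]))

lemma tailIntegral_nonneg (η : ℝ) : 0 ≤ tailIntegral η :=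
  integral_nonneg fun s => (tailDensity_pos s).le

lemma hasDerivAt_tailIntegral (η : ℝ) : HasDerivAt tailIntegral (-tailDensity η) η := by
  have h : tailIntegral = fun x => tailIntegral 0 - ∫ s in (0 : ℝ)..x, tailDensity s := by
    ext x
    rw [← intervalIntegral.integral_Ioi_sub_Ioi' integrable_tailDensity.integrableOn
      integrable_tailDensity.integrableOn]
    simp only [tailIntegral, tailDensity, sub_sub_cancel]
  rw [h]
  exact ((continuous_tailDensity.integral_hasStrictDerivAt 0 η).hasDerivAt).const_sub _

lemma integral_Ioi_exp_neg_sq_div_four :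
    ∫ s in Ioi (0 : ℝ), Real.exp (-s ^ 2 / 4) = √Real.pi := by
  have h := integral_gaussian_Ioi (1 / 4)
  rw [show Real.pi / (1 / 4) = 2 ^ 2 * Real.pi by ring, Real.sqrt_mul (by norm_num),
    Real.sqrt_sq (by norm_num), mul_div_cancel_left₀ _ (by norm_num)] at h
  rw [← h]
  congr with s
  ring_nf

lemma hasDerivAt_exp_neg_sq_div_four (s : ℝ) :
    HasDerivAt (fun s : ℝ => Real.exp (-s ^ 2 / 4)) (Real.exp (-s ^ 2 / 4) * (-(1 / 2) * s)) s := by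
  refine (((hasDerivAt_id' s).pow 2).neg.div_const 4).exp.congr_deriv ?_
  simp only [Nat.cast_ofNat, pow_one, mul_one, Nat.add_one_sub_one, Pi.pow_apply, Pi.neg_apply]
  ring

lemma tendsto_exp_neg_sq_div_four :
    Tendsto (fun s : ℝ => Real.exp (-s ^ 2 / 4)) atTop (𝓝 0) := by
  refine Real.tendsto_exp_atBot.comp ?_
  refine Tendsto.atBot_div_const (by norm_num) (tendsto_neg_atTop_atBot.comp ?_)
  exact tendsto_pow_atTop two_ne_zero

/-- The function `s exp (-s² / 4) / (2 + s²)` vanishes at both ends of the half-line and has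
derivative `4 exp (-s² / 4) / (2 + s²)² - exp (-s² / 4) / 2`, which reduces the integral to the
Gaussian one. -/
lemma tailIntegral_zero : tailIntegral 0 = √Real.pi / 8 := by
  have hderiv : ∀ s ∈ Ici (0 : ℝ),
      HasDerivAt (fun s : ℝ => s / (2 + s ^ 2) * Real.exp (-s ^ 2 / 4))
        (4 * tailDensity s - 1 / 2 * Real.exp (-s ^ 2 / 4)) s := fun s _ => by
    have hne : (2 + s ^ 2) ≠ 0 := by positivity
    refine (((hasDerivAt_id' s).div (((hasDerivAt_id' s).pow 2).const_add 2) hne).mul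
      (hasDerivAt_exp_neg_sq_div_four s)).congr_deriv ?_
    simp only [Nat.cast_ofNat, pow_one, mul_one, Nat.add_one_sub_one, Pi.pow_apply, Pi.div_apply,
      tailDensity]
    field_simp
    ring
  have hint : IntegrableOn
      (fun s : ℝ => 4 * tailDensity s - 1 / 2 * Real.exp (-s ^ 2 / 4)) (Ioi 0) :=
    ((integrable_tailDensity.const_mul 4).sub
      (integrable_exp_neg_sq_div_four.const_mul (1 / 2))).integrableOn
  have hlim : Tendsto (fun s : ℝ => s / (2 + s ^ 2) * Real.exp (-s ^ 2 / 4)) atTop (𝓝 0) := by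
    refine squeeze_zero' ?_ ?_ tendsto_exp_neg_sq_div_four
    · filter_upwards [eventually_ge_atTop 0] with s hs
      positivity
    · refine Eventually.of_forall fun s => mul_le_of_le_one_left (Real.exp_pos _).le ?_
      rw [div_le_one (by positivity)]
      nlinarith [sq_nonneg (s - 1)]
  have h := integral_Ioi_of_hasDerivAt_of_tendsto' hderiv hint hlim
  rw [integral_sub (integrable_tailDensity.const_mul 4).integrableOn
    (integrable_exp_neg_sq_div_four.const_mul (1 / 2)).integrableOn, integral_const_mul,
    integral_const_mul, integral_Ioi_exp_neg_sq_div_four] at h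
  simp only [zero_div, zero_mul, sub_zero] at h
  change ∫ s in Ioi (0 : ℝ), tailDensity s = _
  linarith

/-- The function `1 - (4 / √π) (2 + η²) I(η)`, defined by the same formula on all of `ℝ`. It is
built from the polynomial solution `2 + η²` of `y'' + η y' / 2 - y = 0` by reduction of order. -/
noncomputable def limitSolution (η : ℝ) : ℝ :=
  1 - 4 / √Real.pi * (2 + η ^ 2) * tailIntegral η

/-- The first derivative of `limitSolution`. -/
noncomputable def limitSolutionDeriv (η : ℝ) : ℝ :=
  -(4 / √Real.pi) * (2 * η * tailIntegral η - Real.exp (-η ^ 2 / 4) / (2 + η ^ 2))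

/-- The second derivative of `limitSolution`. -/
noncomputable def limitSolutionDeriv₂ (η : ℝ) : ℝ :=
  -(4 / √Real.pi) * (2 * tailIntegral η + 1 / 2 * η * (Real.exp (-η ^ 2 / 4) / (2 + η ^ 2)))

lemma hasDerivAt_limitSolution (η : ℝ) :
    HasDerivAt limitSolution (limitSolutionDeriv η) η := by
  have hne : (2 + η ^ 2) ≠ 0 := by positivity
  refine ((((((hasDerivAt_id' η).pow 2).const_add 2).const_mul (4 / √Real.pi)).mul
    (hasDerivAt_tailIntegral η)).const_sub 1).congr_deriv ?_
  simp only [Nat.cast_ofNat, pow_one, mul_one, Nat.add_one_sub_one, Pi.pow_apply, tailDensity,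
    limitSolutionDeriv]
  field_simp
  ring

lemma hasDerivAt_limitSolutionDeriv (η : ℝ) :
    HasDerivAt limitSolutionDeriv (limitSolutionDeriv₂ η) η := by
  have hne : (2 + η ^ 2) ≠ 0 := by positivity
  refine (((((hasDerivAt_id' η).const_mul 2).mul (hasDerivAt_tailIntegral η)).sub
    ((hasDerivAt_exp_neg_sq_div_four η).div (((hasDerivAt_id' η).pow 2).const_add 2)
      hne)).const_mul (-(4 / √Real.pi))).congr_deriv ?_
  simp only [Nat.cast_ofNat, pow_one, mul_one, Nat.add_one_sub_one, Pi.pow_apply, tailDensity,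
    limitSolutionDeriv₂]
  field_simp
  ring

lemma limitSolution_ode (η : ℝ) :
    limitSolutionDeriv₂ η + 1 / 2 * η * limitSolutionDeriv η - limitSolution η = -1 := by
  have hne : (2 + η ^ 2) ≠ 0 := by positivity
  unfold limitSolution limitSolutionDeriv limitSolutionDeriv₂
  field_simp
  ring

lemma deriv_limitSolution : deriv limitSolution = limitSolutionDeriv :=
  funext fun η => (hasDerivAt_limitSolution η).deriv

lemma deriv_limitSolutionDeriv : deriv limitSolutionDeriv = limitSolutionDeriv₂ :=
  funext fun η => (hasDerivAt_limitSolutionDeriv η).deriv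

lemma continuous_limitSolution : Continuous limitSolution :=
  continuous_iff_continuousAt.2 fun η => (hasDerivAt_limitSolution η).continuousAt

lemma continuous_limitSolutionDeriv : Continuous limitSolutionDeriv :=
  continuous_iff_continuousAt.2 fun η => (hasDerivAt_limitSolutionDeriv η).continuousAt

lemma continuous_limitSolutionDeriv₂ : Continuous limitSolutionDeriv₂ := by
  have h : limitSolutionDeriv₂ =
      fun η => -1 - 1 / 2 * η * limitSolutionDeriv η + limitSolution η :=
    funext fun η => by linarith [limitSolution_ode η]
  rw [h]
  have := continuous_limitSolution
  have := continuous_limitSolutionDeriv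
  fun_prop

lemma contDiff_limitSolution : ContDiff ℝ 2 limitSolution := by
  refine (contDiff_succ_iff_deriv (n := 1)).2
    ⟨fun η => (hasDerivAt_limitSolution η).differentiableAt, by simp, ?_⟩
  rw [deriv_limitSolution]
  refine contDiff_one_iff_deriv.2
    ⟨fun η => (hasDerivAt_limitSolutionDeriv η).differentiableAt, ?_⟩
  rw [deriv_limitSolutionDeriv]
  exact continuous_limitSolutionDeriv₂

lemma limitSolution_zero : limitSolution 0 = 0 := by
  have : √Real.pi ≠ 0 := by positivity
  rw [limitSolution, tailIntegral_zero]
  field_simp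
  norm_num

lemma limitSolution_le_one (η : ℝ) : limitSolution η ≤ 1 := by
  have := tailIntegral_nonneg η
  have : 0 ≤ 4 / √Real.pi * (2 + η ^ 2) * tailIntegral η := by positivity
  unfold limitSolution
  linarith

lemma tailIntegral_le {η : ℝ} (hη : 0 ≤ η) : tailIntegral η ≤ √Real.pi / (2 + η ^ 2) ^ 2 := by
  calc tailIntegral η ≤ ∫ s in Ioi η, Real.exp (-s ^ 2 / 4) / (2 + η ^ 2) ^ 2 :=
        setIntegral_mono_on integrable_tailDensity.integrableOn
          (integrable_exp_neg_sq_div_four.div_const _).integrableOn measurableSet_Ioi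
          fun s hs => tailDensity_le hη (le_of_lt hs)
    _ ≤ ∫ s in Ioi (0 : ℝ), Real.exp (-s ^ 2 / 4) / (2 + η ^ 2) ^ 2 :=
        setIntegral_mono_set (integrable_exp_neg_sq_div_four.div_const _).integrableOn
          (Eventually.of_forall fun s => by simp only [Pi.zero_apply]; positivity)
          (Ioi_subset_Ioi hη).eventuallyLE
    _ = √Real.pi / (2 + η ^ 2) ^ 2 := by
        rw [integral_div, integral_Ioi_exp_neg_sq_div_four]

lemma tendsto_limitSolution : Tendsto limitSolution atTop (𝓝 1) := by
  have hlim : Tendsto (fun η : ℝ => 1 - 4 / (2 + η ^ 2)) atTop (𝓝 1) := by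
    have : Tendsto (fun η : ℝ => 4 / (2 + η ^ 2)) atTop (𝓝 0) :=
      tendsto_const_nhds.div_atTop
        (tendsto_atTop_add_const_left _ _ (tendsto_pow_atTop two_ne_zero))
    simpa using this.const_sub 1
  refine tendsto_of_tendsto_of_tendsto_of_le_of_le' hlim tendsto_const_nhds ?_
    (Eventually.of_forall limitSolution_le_one)
  filter_upwards [eventually_ge_atTop 0] with η hη
  have hpi : 0 < √Real.pi := by positivity
  have h : 4 / √Real.pi * (2 + η ^ 2) * tailIntegral η
      ≤ 4 / √Real.pi * (2 + η ^ 2) * (√Real.pi / (2 + η ^ 2) ^ 2) := by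
    gcongr
    exact tailIntegral_le hη
  have h' : 4 / √Real.pi * (2 + η ^ 2) * (√Real.pi / (2 + η ^ 2) ^ 2) = 4 / (2 + η ^ 2) := by
    field_simp
  unfold limitSolution
  linarith

lemma limitSolution_monotoneOn : MonotoneOn limitSolution (Ici 0) := by
  refine monotoneOn_of_deriv_nonneg (convex_Ici 0) continuous_limitSolution.continuousOn
    (fun η _ => (hasDerivAt_limitSolution η).differentiableAt.differentiableWithinAt)
    fun η hη => ?_
  rw [interior_Ici] at hη
  rw [deriv_limitSolution]
  exact deriv_nonneg_of_ode_nonpos hasDerivAt_limitSolution hasDerivAt_limitSolutionDeriv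
    (fun x _ => by linarith [limitSolution_ode x, limitSolution_le_one x])
    tendsto_limitSolution (fun x _ => limitSolution_le_one x) (le_of_lt hη)

/-- A zero at `η > 0` would, by monotonicity, make the function vanish on `[0, η]`, where the
differential equation would then read `0 = -1`. -/
lemma limitSolution_pos {η : ℝ} (hη : 0 < η) : 0 < limitSolution η := by
  by_contra! hle
  have hzero : ∀ x ∈ Ioo 0 η, limitSolution x = 0 := fun x hx => by
    refine le_antisymm ((limitSolution_monotoneOn hx.1.le hη.le hx.2.le).trans hle) ?_
    rw [← limitSolution_zero]
    exact limitSolution_monotoneOn self_mem_Ici hx.1.le hx.1.le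
  have hmem : η / 2 ∈ Ioo 0 η := ⟨by linarith, by linarith⟩
  have h0 : limitSolution =ᶠ[𝓝 (η / 2)] fun _ => 0 := by
    filter_upwards [Ioo_mem_nhds hmem.1 hmem.2] using hzero
  have h1 : limitSolutionDeriv =ᶠ[𝓝 (η / 2)] fun _ => 0 := by
    rw [← deriv_limitSolution]
    simpa using h0.deriv
  have h2 : limitSolutionDeriv₂ (η / 2) = 0 := by
    rw [← deriv_limitSolutionDeriv, h1.deriv_eq, deriv_const]
  have := limitSolution_ode (η / 2)
  rw [h2, h1.eq_of_nhds, h0.eq_of_nhds] at this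
  norm_num at this

lemma solvesS0_of_eqOn {v : ℝ → ℝ} (hv : EqOn v limitSolution (Ici 0)) : SolvesS0 v where
  continuousOn := continuous_limitSolution.continuousOn.congr hv
  contDiffOn := contDiff_limitSolution.contDiffOn.congr (hv.mono Ioi_subset_Ici_self)
  ode η hη := by
    have h0 : v =ᶠ[𝓝 η] limitSolution := by
      filter_upwards [Ioi_mem_nhds hη] with x hx using hv (mem_Ici.2 (le_of_lt hx))
    rw [h0.deriv.deriv_eq, h0.deriv_eq, h0.eq_of_nhds, deriv_limitSolution,
      deriv_limitSolutionDeriv]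
    exact limitSolution_ode η
  zero := (hv self_mem_Ici).trans limitSolution_zero
  tendsto_top := tendsto_limitSolution.congr' (by
    filter_upwards [eventually_ge_atTop 0] with x hx using (hv hx).symm)
  pos η hη := by
    rw [hv (le_of_lt hη)]
    exact limitSolution_pos hη

lemma ContDiffOn.hasDerivAt_and_hasDerivAt_deriv {v : ℝ → ℝ} {s : Set ℝ} (hs : IsOpen s)
    (hv : ContDiffOn ℝ 2 v s) {x : ℝ} (hx : x ∈ s) :
    HasDerivAt v (deriv v x) x ∧ HasDerivAt (deriv v) (deriv (deriv v) x) x := by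
  have hd : ContDiffOn ℝ 1 (deriv v) s := hv.deriv_of_isOpen hs (by norm_num)
  exact ⟨((hv.differentiableOn (by norm_num)).differentiableAt (hs.mem_nhds hx)).hasDerivAt,
    ((hd.differentiableOn (by norm_num)).differentiableAt (hs.mem_nhds hx)).hasDerivAt⟩

/-- The boundary value problem is linear, and by the maximum principle the difference of two
solutions vanishes. -/
lemma SolvesS0.eqOn_limitSolution {v : ℝ → ℝ} (hv : SolvesS0 v) :
    EqOn v limitSolution (Ici 0) := by
  intro η hη
  have hd := fun x (hx : 0 < x) => hv.contDiffOn.hasDerivAt_and_hasDerivAt_deriv isOpen_Ioi (mem_Ioi.2 hx)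
  have h := abs_le_of_ode (d := fun x => v x - limitSolution x)
    (d₁ := fun x => deriv v x - limitSolutionDeriv x)
    (d₂ := fun x => deriv (deriv v) x - limitSolutionDeriv₂ x) (g := fun _ => 0) (M := 0)
    (hv.continuousOn.sub continuous_limitSolution.continuousOn)
    (fun x hx => (hd x hx).1.sub (hasDerivAt_limitSolution x))
    (fun x hx => (hd x hx).2.sub (hasDerivAt_limitSolutionDeriv x))
    (fun x hx => by linarith [hv.ode x hx, limitSolution_ode x])
    (hv.tendsto_top.sub tendsto_limitSolution) (by simp)
    (by simp [hv.zero, limitSolution_zero]) (by simp) hη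
  exact sub_eq_zero.1 (abs_nonpos_iff.1 h)

/-! ### The nonlinearity and its potential -/

/-- The positive zero of `u ↦ u ^ p - u / (1 - p)`, the limit at infinity of the profiles. -/
noncomputable def profileLimit (p : ℝ) : ℝ := (1 - p) ^ (1 / (1 - p))

section Nonlinearity

variable {p : ℝ}

lemma profileLimit_pos (hp₁ : p < 1) : 0 < profileLimit p :=
  Real.rpow_pos_of_pos (by linarith) _

lemma profileLimit_le_one (hp₀ : 0 < p) (hp₁ : p < 1) : profileLimit p ≤ 1 :=
  Real.rpow_le_one (by linarith) (by linarith) (one_div_nonneg.2 (by linarith))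

lemma profileLimit_rpow (hp₁ : p < 1) : profileLimit p ^ (1 - p) = 1 - p := by
  rw [profileLimit, ← Real.rpow_mul (by linarith), one_div_mul_cancel (by linarith), Real.rpow_one]

lemma profileLimit_rpow_sub_one (hp₁ : p < 1) : profileLimit p ^ (p - 1) = 1 / (1 - p) := by
  rw [← neg_sub, Real.rpow_neg (profileLimit_pos hp₁).le, profileLimit_rpow hp₁, one_div]

lemma profileLimit_rpow_add_one (hp₁ : p < 1) :
    profileLimit p ^ (p + 1) = profileLimit p ^ 2 / (1 - p) := by
  rw [show p + 1 = (p - 1) + (2 : ℕ) by push_cast; ring,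
    Real.rpow_add_natCast (profileLimit_pos hp₁).ne', profileLimit_rpow_sub_one hp₁]
  ring

lemma quarter_le_profileLimit (hp₀ : 0 < p) (hp : p ≤ 1 / 2) : 1 / 4 ≤ profileLimit p := by
  calc (1 / 4 : ℝ) = (1 / 2) ^ (2 : ℝ) := by norm_num
    _ ≤ (1 / 2) ^ (1 / (1 - p)) := by
        refine Real.rpow_le_rpow_of_exponent_ge (by norm_num) (by norm_num) ?_
        rw [div_le_iff₀ (by linarith)]
        linarith
    _ ≤ profileLimit p :=
        Real.rpow_le_rpow (by norm_num) (by linarith) (one_div_nonneg.2 (by linarith))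

lemma tendsto_profileLimit : Tendsto profileLimit (𝓝 0) (𝓝 1) := by
  have hc : ContinuousAt (fun p : ℝ => 1 - p) 0 := by fun_prop
  have h : ContinuousAt profileLimit 0 :=
    hc.rpow (continuousAt_const.div hc (by norm_num)) (Or.inl (by norm_num))
  simpa [ContinuousAt, profileLimit] using h

lemma fNonlin_of_pos {u : ℝ} (hu : 0 < u) : fNonlin p u = u ^ p := by
  rw [fNonlin, abs_of_pos hu, Real.rpow_sub_one hu.ne']
  field_simp

lemma fNonlin_eq_mul_of_nonneg {u : ℝ} (hu : 0 ≤ u) : fNonlin p u = u * u ^ (p - 1) := by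
  rw [fNonlin, abs_of_nonneg hu]

lemma fNonlin_lt_of_profileLimit_lt (hp₁ : p < 1) {u : ℝ} (hu : profileLimit p < u) :
    fNonlin p u < 1 / (1 - p) * u := by
  have hk := profileLimit_pos hp₁
  rw [fNonlin_eq_mul_of_nonneg (hk.trans hu).le, ← profileLimit_rpow_sub_one hp₁, mul_comm]
  exact mul_lt_mul_of_pos_right (Real.rpow_lt_rpow_of_neg hk hu (by linarith)) (hk.trans hu)

lemma le_fNonlin_of_le_profileLimit (hp₁ : p < 1) {u : ℝ} (h0 : 0 ≤ u)
    (hu : u ≤ profileLimit p) : 1 / (1 - p) * u ≤ fNonlin p u := by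
  rcases h0.eq_or_lt with rfl | h0
  · simp [fNonlin]
  rw [fNonlin_eq_mul_of_nonneg h0.le, ← profileLimit_rpow_sub_one hp₁, mul_comm]
  exact mul_le_mul_of_nonneg_left (Real.rpow_le_rpow_of_nonpos h0 hu (by linarith)) h0.le

lemma fNonlin_le_one (hp₀ : 0 < p) {u : ℝ} (h0 : 0 ≤ u) (h1 : u ≤ 1) : fNonlin p u ≤ 1 := by
  rcases h0.eq_or_lt with rfl | h0
  · simp [fNonlin]
  rw [fNonlin_of_pos h0]
  exact Real.rpow_le_one h0.le h1 hp₀.le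

/-- The primitive `|u|^(p+1) / (p+1) - u² / (2(1-p))` of `u ↦ fNonlin p u - u / (1 - p)`. -/
noncomputable def potential (p u : ℝ) : ℝ :=
  |u| ^ (p + 1) / (p + 1) - u ^ 2 / (2 * (1 - p))

lemma potential_zero (hp₀ : 0 < p) : potential p 0 = 0 := by
  simp [potential, Real.zero_rpow (show p + 1 ≠ 0 by linarith)]

lemma hasDerivAt_potential (hp₀ : 0 < p) (u : ℝ) :
    HasDerivAt (potential p) (fNonlin p u - 1 / (1 - p) * u) u := by
  refine (((hasDerivAt_abs_rpow u (show 1 < p + 1 by linarith)).div_const (p + 1)).sub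
    (((hasDerivAt_id' u).pow 2).div_const (2 * (1 - p)))).congr_deriv ?_
  rw [fNonlin, show p + 1 - 2 = p - 1 by ring]
  have : p + 1 ≠ 0 := by linarith
  simp only [Nat.cast_ofNat, pow_one, mul_one, Nat.add_one_sub_one]
  rw [mul_assoc, mul_div_cancel_left₀ _ this, mul_div_mul_left _ _ two_ne_zero]
  ring

lemma potential_profileLimit (hp₀ : 0 < p) (hp₁ : p < 1) :
    potential p (profileLimit p) = profileLimit p ^ 2 / (2 * (1 + p)) := by
  rw [potential, abs_of_pos (profileLimit_pos hp₁), profileLimit_rpow_add_one hp₁]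
  have h₁ : 1 - p ≠ 0 := by linarith
  have h₂ : p + 1 ≠ 0 := by linarith
  rw [add_comm 1 p]
  field_simp
  ring

/-- The constant states `± profileLimit p` are the global maxima of the potential: this is
Bernoulli's inequality for the power `(p + 1) / 2` of `u² / (profileLimit p)²`. -/
lemma potential_le (hp₀ : 0 < p) (hp₁ : p < 1) (u : ℝ) :
    potential p u ≤ potential p (profileLimit p) := by
  have hk := profileLimit_pos hp₁
  rw [potential_profileLimit hp₀ hp₁]
  set k := profileLimit p with hkdef
  have hb := rpow_one_add_le_one_add_mul_self (s := u ^ 2 / k ^ 2 - 1)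
    (by linarith [show 0 ≤ u ^ 2 / k ^ 2 by positivity]) (p := (p + 1) / 2) (by linarith)
    (by linarith)
  have hpow : ∀ x : ℝ, 0 ≤ x → (x ^ 2) ^ ((p + 1) / 2) = x ^ (p + 1) := fun x hx => by
    rw [← Real.rpow_natCast, ← Real.rpow_mul hx]
    congr 1
    push_cast
    ring
  rw [add_sub_cancel, ← sq_abs u, Real.div_rpow (by positivity) (by positivity),
    hpow _ (abs_nonneg u), hpow _ hk.le, profileLimit_rpow_add_one hp₁, ← hkdef, sq_abs,
    div_le_iff₀ (by have : 0 < 1 - p := (by linarith); positivity)] at hb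
  have h₁ : 1 - p ≠ 0 := by linarith
  have h₂ : p + 1 ≠ 0 := by linarith
  have h₃ : 0 < p + 1 := by linarith
  calc potential p u ≤ (1 + (p + 1) / 2 * (u ^ 2 / k ^ 2 - 1)) * (k ^ 2 / (1 - p)) / (p + 1)
        - u ^ 2 / (2 * (1 - p)) := by
        unfold potential
        gcongr
    _ = k ^ 2 / (2 * (1 + p)) := by
        rw [add_comm 1 p]
        field_simp
        ring

end Nonlinearity

/-! ### Estimates for self-similar profiles -/

namespace IsSelfSimilarProfile

variable {p : ℝ} {w : ℝ → ℝ}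

lemma hasDerivAt (hw : IsSelfSimilarProfile p w) (x : ℝ) : HasDerivAt w (deriv w x) x :=
  (hw.contDiff.contDiffOn.hasDerivAt_and_hasDerivAt_deriv isOpen_univ (mem_univ x)).1

lemma hasDerivAt_deriv (hw : IsSelfSimilarProfile p w) (x : ℝ) :
    HasDerivAt (deriv w) (deriv (deriv w) x) x :=
  (hw.contDiff.contDiffOn.hasDerivAt_and_hasDerivAt_deriv isOpen_univ (mem_univ x)).2

lemma map_zero (hw : IsSelfSimilarProfile p w) : w 0 = 0 := by
  have := hw.odd 0
  rw [neg_zero] at this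
  linarith

lemma tendsto_profileLimit (hw : IsSelfSimilarProfile p w) :
    Tendsto w atTop (𝓝 (profileLimit p)) := hw.tendsto_top

/-- The energy `w'² / 2 + potential p w` is dissipated at the rate `η w'² / 2`. -/
lemma hasDerivAt_energy (hp₀ : 0 < p) (hw : IsSelfSimilarProfile p w) (x : ℝ) :
    HasDerivAt (fun x => deriv w x ^ 2 / 2 + potential p (w x))
      (-(1 / 2 * x * deriv w x ^ 2)) x := by
  refine ((((hw.hasDerivAt_deriv x).pow 2).div_const 2).add
    ((hasDerivAt_potential hp₀ (w x)).comp x (hw.hasDerivAt x))).congr_deriv ?_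
  simp only [Nat.cast_ofNat, pow_one, Nat.add_one_sub_one]
  linear_combination deriv w x * hw.ode x

lemma energy_antitoneOn (hp₀ : 0 < p) (hw : IsSelfSimilarProfile p w) :
    AntitoneOn (fun x => deriv w x ^ 2 / 2 + potential p (w x)) (Ici 0) := by
  refine antitoneOn_of_deriv_nonpos (convex_Ici 0)
    (fun x _ => (hw.hasDerivAt_energy hp₀ x).continuousAt.continuousWithinAt)
    (fun x _ => (hw.hasDerivAt_energy hp₀ x).differentiableAt.differentiableWithinAt)
    fun x hx => ?_
  rw [interior_Ici] at hx
  rw [(hw.hasDerivAt_energy hp₀ x).deriv]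
  have : 0 < x := hx
  exact neg_nonpos.2 (by positivity)

/-- The energy is at least that of the constant state reached at infinity. -/
lemma potential_le_energy (hp₀ : 0 < p) (hw : IsSelfSimilarProfile p w) {x : ℝ} (hx : 0 ≤ x) :
    potential p (profileLimit p) ≤ deriv w x ^ 2 / 2 + potential p (w x) := by
  refine le_of_tendsto
    ((hasDerivAt_potential hp₀ _).continuousAt.tendsto.comp hw.tendsto_profileLimit) ?_
  filter_upwards [eventually_ge_atTop x] with y hy
  have h : deriv w y ^ 2 / 2 + potential p (w y) ≤ deriv w x ^ 2 / 2 + potential p (w x) :=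
    hw.energy_antitoneOn hp₀ hx (hx.trans hy) hy
  simp only [Function.comp_apply]
  linarith [sq_nonneg (deriv w y)]

/-- Between `0` and a further zero `a` there is a critical point `c`, whose energy is at most the
maximum of the potential. As the energy never drops below that maximum, it is constant on `[c, ∞)`;
then `w'` vanishes at `a` as well, and the energy there would be zero. -/
lemma ne_zero_of_pos (hp₀ : 0 < p) (hp₁ : p < 1) (hw : IsSelfSimilarProfile p w) {a : ℝ}
    (ha : 0 < a) : w a ≠ 0 := by
  intro hwa
  obtain ⟨c, hc, hwc⟩ := exists_hasDerivAt_eq_zero ha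
    (fun x _ => (hw.hasDerivAt x).continuousAt.continuousWithinAt)
    (hw.map_zero.trans hwa.symm) fun x _ => hw.hasDerivAt x
  have hconst : (fun x => deriv w x ^ 2 / 2 + potential p (w x)) =ᶠ[𝓝 a]
      fun _ => potential p (profileLimit p) := by
    filter_upwards [Ioi_mem_nhds hc.2] with x hx
    have hcx : c < x := hx
    refine le_antisymm ?_ (hw.potential_le_energy hp₀ (hc.1.trans hcx).le)
    have h : deriv w x ^ 2 / 2 + potential p (w x) ≤ deriv w c ^ 2 / 2 + potential p (w c) :=
      hw.energy_antitoneOn hp₀ hc.1.le (hc.1.trans hcx).le hcx.le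
    rw [hwc] at h
    linarith [potential_le hp₀ hp₁ (w c)]
  have hderiv : deriv w a = 0 := by
    have h := (hw.hasDerivAt_energy hp₀ a).deriv
    rw [hconst.deriv_eq, deriv_const] at h
    simpa [ha.ne'] using h
  have h := hconst.eq_of_nhds
  rw [hderiv, hwa, potential_zero hp₀, potential_profileLimit hp₀ hp₁] at h
  have : 0 < profileLimit p ^ 2 / (2 * (1 + p)) := by
    have := profileLimit_pos hp₁
    positivity
  linarith

lemma pos (hp₀ : 0 < p) (hp₁ : p < 1) (hw : IsSelfSimilarProfile p w) {x : ℝ} (hx : 0 < x) :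
    0 < w x := by
  by_contra! hle
  obtain ⟨y, hxy, hy⟩ := ((eventually_ge_atTop x).and
    (hw.tendsto_profileLimit.eventually_const_lt (profileLimit_pos hp₁))).exists
  obtain ⟨z, hz, hwz⟩ := intermediate_value_Icc hxy hw.contDiff.continuous.continuousOn
    ⟨hle, hy.le⟩
  exact hw.ne_zero_of_pos hp₀ hp₁ (hx.trans_le hz.1) hwz

lemma nonneg (hp₀ : 0 < p) (hp₁ : p < 1) (hw : IsSelfSimilarProfile p w) {x : ℝ} (hx : 0 ≤ x) :
    0 ≤ w x := by
  rcases hx.eq_or_lt with rfl | hx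
  · exact hw.map_zero.ge
  · exact (hw.pos hp₀ hp₁ hx).le

lemma le_profileLimit (hp₁ : p < 1) (hw : IsSelfSimilarProfile p w) {x : ℝ}
    (hx : 0 ≤ x) : w x ≤ profileLimit p := by
  refine le_of_maximum_principle hw.contDiff.continuous.continuousOn
    (fun x _ => hw.hasDerivAt x) (fun x _ => hw.hasDerivAt_deriv x) hw.tendsto_profileLimit le_rfl
    (by rw [hw.map_zero]; exact (profileLimit_pos hp₁).le) (fun y _ hy hlt => ?_) x hx
  have h := hw.ode y
  rw [hy] at h
  linarith [fNonlin_lt_of_profileLimit_lt hp₁ hlt]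

lemma le_one (hp₀ : 0 < p) (hp₁ : p < 1) (hw : IsSelfSimilarProfile p w) {x : ℝ}
    (hx : 0 ≤ x) : w x ≤ 1 :=
  (hw.le_profileLimit hp₁ hx).trans (profileLimit_le_one hp₀ hp₁)

lemma ode_nonpos (hp₀ : 0 < p) (hp₁ : p < 1) (hw : IsSelfSimilarProfile p w) {x : ℝ}
    (hx : 0 ≤ x) : deriv (deriv w) x + 1 / 2 * x * deriv w x ≤ 0 := by
  linarith [hw.ode x, le_fNonlin_of_le_profileLimit hp₁ (hw.nonneg hp₀ hp₁ hx)
    (hw.le_profileLimit hp₁ hx)]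

lemma neg_one_le_ode (hp₀ : 0 < p) (hp₁ : p < 1) (hw : IsSelfSimilarProfile p w) {x : ℝ}
    (hx : 0 ≤ x) : -1 ≤ deriv (deriv w) x + 1 / 2 * x * deriv w x := by
  have h0 := hw.nonneg hp₀ hp₁ hx
  have : 0 ≤ 1 / (1 - p) * w x := mul_nonneg (one_div_nonneg.2 (by linarith)) h0
  linarith [hw.ode x, fNonlin_le_one hp₀ h0 (hw.le_one hp₀ hp₁ hx)]

lemma deriv_nonneg (hp₀ : 0 < p) (hp₁ : p < 1) (hw : IsSelfSimilarProfile p w) {x : ℝ}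
    (hx : 0 ≤ x) : 0 ≤ deriv w x :=
  deriv_nonneg_of_ode_nonpos hw.hasDerivAt hw.hasDerivAt_deriv
    (fun _ hx => hw.ode_nonpos hp₀ hp₁ hx) hw.tendsto_profileLimit
    (fun _ hx => hw.le_profileLimit hp₁ hx) hx

lemma deriv_deriv_nonpos (hp₀ : 0 < p) (hp₁ : p < 1) (hw : IsSelfSimilarProfile p w) {x : ℝ}
    (hx : 0 ≤ x) : deriv (deriv w) x ≤ 0 := by
  have : 0 ≤ 1 / 2 * x * deriv w x := mul_nonneg (by linarith) (hw.deriv_nonneg hp₀ hp₁ hx)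
  linarith [hw.ode_nonpos hp₀ hp₁ hx]

lemma deriv_antitoneOn (hp₀ : 0 < p) (hp₁ : p < 1) (hw : IsSelfSimilarProfile p w) :
    AntitoneOn (deriv w) (Ici 0) := by
  refine antitoneOn_of_deriv_nonpos (convex_Ici 0)
    (fun x _ => (hw.hasDerivAt_deriv x).continuousAt.continuousWithinAt)
    (fun x _ => (hw.hasDerivAt_deriv x).differentiableAt.differentiableWithinAt) fun x hx => ?_
  rw [interior_Ici] at hx
  exact hw.deriv_deriv_nonpos hp₀ hp₁ (le_of_lt hx)

/-- A slope above `4` at the origin would persist on `[0, 1]` at a size above `1`,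
contradicting `w ≤ 1`. -/
lemma deriv_le_four (hp₀ : 0 < p) (hp₁ : p < 1) (hw : IsSelfSimilarProfile p w) {x : ℝ}
    (hx : 0 ≤ x) : deriv w x ≤ 4 := by
  have hanti := hw.deriv_antitoneOn hp₀ hp₁
  refine (hanti self_mem_Ici hx hx).trans ?_
  obtain ⟨ξ, hξ, hslope⟩ := exists_hasDerivAt_eq_slope w (deriv w) zero_lt_one
    (fun y _ => (hw.hasDerivAt y).continuousAt.continuousWithinAt) fun y _ => hw.hasDerivAt y
  obtain ⟨ζ, hζ, hslope'⟩ := exists_hasDerivAt_eq_slope (deriv w) (deriv (deriv w)) zero_lt_one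
    (fun y _ => (hw.hasDerivAt_deriv y).continuousAt.continuousWithinAt)
    fun y _ => hw.hasDerivAt_deriv y
  rw [hw.map_zero, sub_zero, sub_zero, div_one] at hslope
  rw [sub_zero, div_one] at hslope'
  have h₁ : deriv w 1 ≤ deriv w ξ := hanti hξ.1.le (mem_Ici.2 zero_le_one) hξ.2.le
  have h₂ : deriv w ζ ≤ deriv w 0 := hanti self_mem_Ici hζ.1.le hζ.1.le
  have h₃ := hw.neg_one_le_ode hp₀ hp₁ hζ.1.le
  have h₄ : ζ * deriv w ζ ≤ 1 * deriv w 0 :=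
    mul_le_mul hζ.2.le h₂ (hw.deriv_nonneg hp₀ hp₁ hζ.1.le) zero_le_one
  linarith [hw.le_one hp₀ hp₁ zero_le_one]

lemma neg_le_deriv_deriv (hp₀ : 0 < p) (hp₁ : p < 1) (hw : IsSelfSimilarProfile p w) {x : ℝ}
    (hx : 0 ≤ x) : -(2 * x + 1) ≤ deriv (deriv w) x := by
  have := mul_le_mul_of_nonneg_left (hw.deriv_le_four hp₀ hp₁ hx) hx
  linarith [hw.neg_one_le_ode hp₀ hp₁ hx]

lemma monotoneOn (hp₀ : 0 < p) (hp₁ : p < 1) (hw : IsSelfSimilarProfile p w) :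
    MonotoneOn w (Ici 0) := by
  refine monotoneOn_of_deriv_nonneg (convex_Ici 0) hw.contDiff.continuous.continuousOn
    (fun x _ => (hw.hasDerivAt x).differentiableAt.differentiableWithinAt) fun x hx => ?_
  rw [interior_Ici] at hx
  exact hw.deriv_nonneg hp₀ hp₁ (le_of_lt hx)

/-- At the origin the energy is `w'(0)² / 2`, which keeps the slope there away from zero. -/
lemma sixth_le_deriv_zero (hp₀ : 0 < p) (hp : p ≤ 1 / 2) (hw : IsSelfSimilarProfile p w) :
    1 / 6 ≤ deriv w 0 := by
  have hp₁ : p < 1 := by linarith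
  have h := hw.potential_le_energy hp₀ le_rfl
  rw [hw.map_zero, potential_zero hp₀, potential_profileLimit hp₀ hp₁] at h
  have hk := quarter_le_profileLimit hp₀ hp
  have h₁ : (1 / 4 : ℝ) ^ 2 / 3 ≤ profileLimit p ^ 2 / (2 * (1 + p)) := by
    gcongr
    linarith
  refine le_of_sq_le_sq ?_ (hw.deriv_nonneg hp₀ hp₁ le_rfl)
  linarith

/-- A lower bound on `[δ, ∞)` that does not depend on the exponent. -/
lemma le_of_le (hp₀ : 0 < p) (hp : p ≤ 1 / 2) (hw : IsSelfSimilarProfile p w) {δ x : ℝ}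
    (hδ₀ : 0 < δ) (hδ : δ ≤ 1 / 36) (hx : δ ≤ x) : δ / 12 ≤ w x := by
  have hp₁ : p < 1 := by linarith
  refine le_trans ?_ (hw.monotoneOn hp₀ hp₁ hδ₀.le (hδ₀.le.trans hx) hx)
  obtain ⟨ξ, hξ, hslope⟩ := exists_hasDerivAt_eq_slope w (deriv w) hδ₀
    (fun y _ => (hw.hasDerivAt y).continuousAt.continuousWithinAt) fun y _ => hw.hasDerivAt y
  obtain ⟨ζ, hζ, hslope'⟩ := exists_hasDerivAt_eq_slope (deriv w) (deriv (deriv w)) hξ.1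
    (fun y _ => (hw.hasDerivAt_deriv y).continuousAt.continuousWithinAt)
    fun y _ => hw.hasDerivAt_deriv y
  rw [hw.map_zero, sub_zero, sub_zero, eq_div_iff hδ₀.ne'] at hslope
  rw [sub_zero, eq_div_iff hξ.1.ne'] at hslope'
  have h₁ : -3 ≤ deriv (deriv w) ζ := by
    linarith [hw.neg_le_deriv_deriv hp₀ hp₁ hζ.1.le, hζ.2, hξ.2]
  have h₂ := mul_le_mul_of_nonneg_right h₁ hξ.1.le
  have h₃ : 1 / 12 ≤ deriv w ξ := by
    linarith [hw.sixth_le_deriv_zero hp₀ hp, hξ.2]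
  linarith [mul_le_mul_of_nonneg_right h₃ hδ₀.le]

lemma le_four_mul (hp₀ : 0 < p) (hp₁ : p < 1) (hw : IsSelfSimilarProfile p w) {x : ℝ}
    (hx : 0 ≤ x) : w x ≤ 4 * x := by
  have h := (convex_Ici (0 : ℝ)).image_sub_le_mul_sub_of_deriv_le
    hw.contDiff.continuous.continuousOn
    (fun x _ => (hw.hasDerivAt x).differentiableAt.differentiableWithinAt) (C := 4)
    (fun y hy => by
      rw [interior_Ici] at hy
      exact hw.deriv_le_four hp₀ hp₁ (le_of_lt hy)) 0 self_mem_Ici x hx hx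
  rwa [hw.map_zero, sub_zero, sub_zero] at h

/-! ### Convergence as the exponent tends to zero -/

/-- Away from the origin `fNonlin p w` is close to `1`, so `w` almost solves the limit equation. -/
lemma abs_ode_error_le (hp₀ : 0 < p) (hp : p ≤ 1 / 2) (hw : IsSelfSimilarProfile p w) {δ x : ℝ}
    (hδ₀ : 0 < δ) (hδ : δ ≤ 1 / 36) (hx : δ ≤ x) :
    |deriv (deriv w) x + 1 / 2 * x * deriv w x - w x + 1| ≤
      1 - (δ / 12) ^ p + p / (1 - p) := by
  have hp₁ : p < 1 := by linarith
  have hx₀ : 0 < x := hδ₀.trans_le hx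
  have hwx := hw.pos hp₀ hp₁ hx₀
  have hw₁ := hw.le_one hp₀ hp₁ hx₀.le
  have hode := hw.ode x
  rw [fNonlin_of_pos hwx] at hode
  have h₁ : w x ^ p ≤ 1 := Real.rpow_le_one hwx.le hw₁ hp₀.le
  have h₂ : (δ / 12) ^ p ≤ w x ^ p :=
    Real.rpow_le_rpow (by positivity) (hw.le_of_le hp₀ hp hδ₀ hδ hx) hp₀.le
  have h₃ : 1 / (1 - p) * w x = w x + p / (1 - p) * w x := by
    have : 1 - p ≠ 0 := by linarith
    field_simp
    ring
  have h₄ : 0 ≤ p / (1 - p) := div_nonneg hp₀.le (by linarith)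
  have h₅ : p / (1 - p) * w x ≤ p / (1 - p) := mul_le_of_le_one_right h₄ hw₁
  have h₆ : 0 ≤ p / (1 - p) * w x := mul_nonneg h₄ hwx.le
  rw [abs_le]
  constructor <;> linarith

end IsSelfSimilarProfile

/-- Uniform convergence on the half-line. Near the origin both functions are small; on the rest the
maximum principle applies to the difference. -/
lemma eventually_abs_sub_limitSolution_le {ε : ℝ} (hε : 0 < ε) :
    ∀ᶠ p in 𝓝[>] (0 : ℝ), ∀ w, IsSelfSimilarProfile p w →
      ∀ x, 0 ≤ x → |w x - limitSolution x| ≤ ε := by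
  obtain ⟨r, hr, hr'⟩ := Metric.continuousAt_iff.1
    (continuous_limitSolution.continuousAt (x := 0)) (ε / 2) (half_pos hε)
  obtain ⟨δ, hδ₀, hδ⟩ : ∃ δ > 0, δ < min r (min (1 / 36) (ε / 8)) :=
    exists_between (by positivity)
  obtain ⟨hδr, hδ₁, hδε⟩ : δ < r ∧ δ < 1 / 36 ∧ δ < ε / 8 := by simpa using hδ
  have herr : Tendsto (fun p : ℝ => 1 - (δ / 12) ^ p + p / (1 - p)) (𝓝[>] 0) (𝓝 0) := by
    have hc : ContinuousAt (fun p : ℝ => 1 - (δ / 12) ^ p + p / (1 - p)) 0 :=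
      (continuousAt_const.sub (Real.continuousAt_const_rpow (by positivity))).add
        (continuousAt_id.div (continuousAt_const.sub continuousAt_id) (by norm_num))
    refine tendsto_nhdsWithin_of_tendsto_nhds ?_
    simpa [ContinuousAt] using hc
  have hlim : Tendsto (fun p => |profileLimit p - 1|) (𝓝[>] 0) (𝓝 0) := by
    refine tendsto_nhdsWithin_of_tendsto_nhds ?_
    simpa using (tendsto_profileLimit.sub_const 1).abs
  filter_upwards [Ioo_mem_nhdsGT (show (0 : ℝ) < 1 / 2 by norm_num),
    herr.eventually_le_const hε, hlim.eventually_le_const hε] with p hp hpe hpl w hw x hx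
  have hp₁ : p < 1 := by linarith [hp.2]
  have hnear : ∀ y, 0 ≤ y → y ≤ δ → |w y - limitSolution y| ≤ ε := fun y hy hyδ => by
    have h₁ := hr' (x := y) (by rw [dist_zero_right, Real.norm_of_nonneg hy]; linarith)
    rw [limitSolution_zero, dist_zero_right, Real.norm_eq_abs] at h₁
    have h₂ := hw.nonneg hp.1 hp₁ hy
    have h₃ := hw.le_four_mul hp.1 hp₁ hy
    rw [abs_le]
    constructor <;> linarith [abs_lt.1 h₁]
  rcases le_total x δ with hxδ | hxδ
  · exact hnear x hx hxδ
  · exact abs_le_of_ode (d := fun x => w x - limitSolution x)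
      (d₁ := fun x => deriv w x - limitSolutionDeriv x)
      (d₂ := fun x => deriv (deriv w) x - limitSolutionDeriv₂ x)
      (g := fun x => deriv (deriv w) x + 1 / 2 * x * deriv w x - w x + 1)
      (hw.contDiff.continuous.sub continuous_limitSolution).continuousOn
      (fun x _ => (hw.hasDerivAt x).sub (hasDerivAt_limitSolution x))
      (fun x _ => (hw.hasDerivAt_deriv x).sub (hasDerivAt_limitSolutionDeriv x))
      (fun x _ => by linarith [limitSolution_ode x])
      (hw.tendsto_profileLimit.sub tendsto_limitSolution) hpl (hnear δ hδ₀.le le_rfl)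
      (fun x hx => (hw.abs_ode_error_le hp.1 hp.2.le hδ₀ hδ₁.le hx.le).trans hpe) hxδ

/-- Convergence of the derivatives on bounded intervals, by interpolation with the uniform bounds
for the second derivatives. -/
lemma eventually_abs_deriv_sub_limitSolutionDeriv_le {ε : ℝ} (hε : 0 < ε) (X : ℝ) :
    ∀ᶠ p in 𝓝[>] (0 : ℝ), ∀ w, IsSelfSimilarProfile p w →
      ∀ x ∈ Icc 0 X, |deriv w x - limitSolutionDeriv x| ≤ ε := by
  obtain ⟨C, hC⟩ := isCompact_Icc.exists_bound_of_continuousOn (s := Icc 0 (X + 1))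
    continuous_limitSolutionDeriv₂.continuousOn
  set K : ℝ := 2 * (X + 1) + 1 + C with hK
  obtain ⟨h, hh₀, hh⟩ : ∃ h > 0, h < min 1 (ε / (2 * (|K| + 1))) :=
    exists_between (by positivity)
  obtain ⟨hh₁, hhK⟩ : h < 1 ∧ h < ε / (2 * (|K| + 1)) := by simpa using hh
  have hKh : K * h ≤ ε / 2 := by
    rw [lt_div_iff₀ (by positivity)] at hhK
    have := mul_le_mul_of_nonneg_right (le_abs_self K) hh₀.le
    linarith
  filter_upwards [Ioo_mem_nhdsGT (show (0 : ℝ) < 1 by norm_num),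
    eventually_abs_sub_limitSolution_le (ε := ε * h / 4) (by positivity)] with p hp hd w hw x hx
  have hbound := abs_deriv_le_of_abs_le (d := fun x => w x - limitSolution x)
    (d₁ := fun x => deriv w x - limitSolutionDeriv x)
    (d₂ := fun x => deriv (deriv w) x - limitSolutionDeriv₂ x) (K := K) (x := x) hh₀
    (fun x => (hw.hasDerivAt x).sub (hasDerivAt_limitSolution x))
    (fun x => (hw.hasDerivAt_deriv x).sub (hasDerivAt_limitSolutionDeriv x))
    (fun y hy => hd w hw y (hx.1.trans hy.1)) (fun y hy => by
      have hy₀ : 0 ≤ y := hx.1.trans hy.1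
      have hyX : y ≤ X + 1 := by linarith [hy.2, hx.2]
      have h₁ := hC y ⟨hy₀, hyX⟩
      rw [Real.norm_eq_abs] at h₁
      have h₂ := hw.deriv_deriv_nonpos hp.1 hp.2 hy₀
      have h₃ := hw.neg_le_deriv_deriv hp.1 hp.2 hy₀
      rw [abs_le]
      constructor <;> linarith [abs_le.1 h₁])
  have h₁ : 2 * (ε * h / 4) / h = ε / 2 := by
    field_simp
    norm_num
  rw [h₁] at hbound
  linarith

lemma tendsto_pSeq : Tendsto pSeq atTop (𝓝[>] 0) := by
  refine tendsto_nhdsWithin_iff.2 ⟨?_, ?_⟩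
  · exact tendsto_const_nhds.div_atTop
      (tendsto_natCast_atTop_atTop.const_mul_atTop (by norm_num))
  · filter_upwards [eventually_ge_atTop 1] with n hn
    have : 0 < n := hn
    simp only [pSeq, mem_Ioi]
    positivity

/-- The limit does not depend on the choice of a subsequence or of the profiles. -/
lemma tendstoC1On_limitSolution {w : ℝ → ℝ → ℝ}
    (hw : ∀ n : ℕ, 1 ≤ n → IsSelfSimilarProfile (pSeq n) (w (pSeq n))) {φ : ℕ → ℕ}
    (hφ : StrictMono φ) (hφ₁ : ∀ l, 1 ≤ φ l) (X : ℝ) :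
    TendstoC1On (fun l => w (pSeq (φ l))) limitSolution X := by
  have hp : Tendsto (fun l => pSeq (φ l)) atTop (𝓝[>] 0) := tendsto_pSeq.comp hφ.tendsto_atTop
  constructor
  · refine Metric.tendstoUniformlyOn_iff.2 fun ε hε => ?_
    filter_upwards [hp.eventually (eventually_abs_sub_limitSolution_le (half_pos hε))] with l hl x hx
    rw [dist_comm, Real.dist_eq]
    linarith [hl _ (hw _ (hφ₁ l)) x hx.1]
  · refine Metric.tendstoUniformlyOn_iff.2 fun ε hε => ?_
    filter_upwards [hp.eventually
      (eventually_abs_deriv_sub_limitSolutionDeriv_le (half_pos hε) X)] with l hl x hx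
    rw [(hasDerivAt_limitSolution x).hasDerivWithinAt.derivWithin
      (uniqueDiffOn_Ici 0 x hx.1), dist_comm, Real.dist_eq]
    linarith [hl _ (hw _ (hφ₁ l)) x hx]

lemma IsLimitProfile.eqOn_limitSolution {w : ℝ → ℝ → ℝ}
    (hw : ∀ n : ℕ, 1 ≤ n → IsSelfSimilarProfile (pSeq n) (w (pSeq n))) {v : ℝ → ℝ}
    (hv : IsLimitProfile (fun n => w (pSeq n)) v) : EqOn v limitSolution (Ici 0) := by
  intro η hη
  have hη₀ : 0 ≤ η := hη
  obtain ⟨φ, hφ, hφ₁, hlim⟩ := hv.2 (η + 1) (by linarith)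
  have hmem : η ∈ Icc 0 (η + 1) := ⟨hη₀, by linarith⟩
  exact tendsto_nhds_unique (hlim.1.tendsto_at hmem)
    ((tendstoC1On_limitSolution hw hφ hφ₁ (η + 1)).1.tendsto_at hmem)

theorem mainTheorem6 :
    -- the integral defining `I(η)` converges
    (∀ η : ℝ, 0 ≤ η →
      IntegrableOn (fun s : ℝ => Real.exp (-s ^ 2 / 4) / (2 + s ^ 2) ^ 2) (Ioi η)) ∧
    -- `(S₀)` has exactly one solution on `[0, ∞)`, given by the explicit formula
    (∀ v : ℝ → ℝ, SolvesS0 v ↔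
      ∀ η : ℝ, 0 ≤ η → v η = 1 - 4 / √Real.pi * (2 + η ^ 2) * tailIntegral η) ∧
    ∀ w : ℝ → ℝ → ℝ, (∀ n : ℕ, 1 ≤ n → IsSelfSimilarProfile (pSeq n) (w (pSeq n))) →
      -- a limit profile exists; one subsequence serves all intervals `[0, X]`
      (∃ v : ℝ → ℝ, ContDiffOn ℝ 1 v (Ici 0) ∧
        ∃ φ : ℕ → ℕ, StrictMono φ ∧ (∀ l, 1 ≤ φ l) ∧
          ∀ X : ℝ, 0 < X → TendstoC1On (fun l => w (pSeq (φ l))) v X) ∧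
      -- every limit profile is the solution of `(S₀)` and is given by the formula
      (∀ v : ℝ → ℝ, IsLimitProfile (fun n => w (pSeq n)) v →
        SolvesS0 v ∧
          ∀ η : ℝ, 0 ≤ η → v η = 1 - 4 / √Real.pi * (2 + η ^ 2) * tailIntegral η) := by
  refine ⟨fun η _ => integrable_tailDensity.integrableOn,
    fun v => ⟨fun hv η hη => hv.eqOn_limitSolution hη, fun hv =>
      solvesS0_of_eqOn fun η hη => hv η hη⟩,
    fun w hw => ⟨⟨limitSolution, (contDiff_limitSolution.of_le (by norm_num)).contDiffOn,
      fun l => l + 1, fun _ _ h => Nat.add_lt_add_right h 1, fun l => Nat.le_add_left 1 l,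
      fun X _ => tendstoC1On_limitSolution hw (fun _ _ h => Nat.add_lt_add_right h 1)
        (fun l => Nat.le_add_left 1 l) X⟩, fun v hv => ?_⟩⟩
  have h := hv.eqOn_limitSolution hw
  exact ⟨solvesS0_of_eqOn h, fun η hη => h hη⟩
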